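/- Let $K$ be an algebraically closed field of characteristic $0$, let $s,d,k\ge 0$ be integers, and let $\mathcal P=(P_1,\dots,P_s)$ be polynomials in $K[X_1,\dots,X_k]$ of total degree at most $d$. For a zero pattern $\rho\in\{0,1\}^s$ let its realization be $$\mathcal R(\rho)=\{x\in K^k \mid \text{for every } i,\ P_i(x)=0 \text{ if and only if } \rho_i=0\},$$ and call $\rho$ realizable if $\mathcal R(\rho)\neq\emptyset$. The dimension of $\mathcal R(\rho)$ is the dimension, over $K$, of its Zariski closure in $K^k$. Then for every $0\le \ell\le k$ the number of realizable zero patterns $\rho$ with $\dim\mathcal R(\rho)=\ell$ is at most $$\binom{s}{k-\ell}d^{\,k-\ell}.$$ Consequently the total number of realizable zero patterns is at most $$\sum_{\ell=0}^{k}\binom{s}{k-\ell}d^{\,k-\ell}.$$ Here $0^0=1$. -/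

import Mathlib

/-- `sz x = 0` if `x = 0`, and `sz x = 1` otherwise. -/
noncomputable def sz {K : Type*} [Zero K] (x : K) : Fin 2 :=
  open Classical in if x = 0 then 0 else 1

/-- The realization in `K ^ k` of the zero pattern `ρ ∈ {0,1}^s` on the family `P` of `s`
polynomials in `k` variables: the points at which `P i` vanishes exactly when `ρ i = 0`. -/
def realization {K : Type*} [Field K] {s k : ℕ} (P : Fin s → MvPolynomial (Fin k) K)
    (ρ : Fin s → Fin 2) : Set (Fin k → K) :=
  {x | ∀ i, sz (MvPolynomial.eval x (P i)) = ρ i}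

/-- The dimension of a subset `S` of affine space `K ^ k`, that is, of its Zariski closure:
the Krull dimension of the coordinate ring `K[X₁, …, X_k] ⧸ I(S)`.
It is `⊥` exactly when `S` is empty. -/
noncomputable def zariskiDim {K : Type*} [Field K] {k : ℕ} (S : Set (Fin k → K)) : WithBot ℕ∞ :=
  ringKrullDim (MvPolynomial (Fin k) K ⧸ MvPolynomial.vanishingIdeal K S)

/-- The set of realizable zero patterns on the family `P`. -/
def zeroPatterns {K : Type*} [Field K] {s k : ℕ} (P : Fin s → MvPolynomial (Fin k) K) :
    Set (Fin s → Fin 2) :=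
  {ρ | (realization P ρ).Nonempty}

/-!
Write `R = K[X₁, …, X_k]`. To a zero pattern `ρ` whose realization has dimension `ℓ` one attaches,
by the Nullstellensatz, a prime `q` of `R` with `dim R ⧸ q = ℓ` that is minimal over the ideal of
those `P i` it contains, and contains `P i` exactly when `ρ i = 0`; in particular `q` determines
`ρ` (`exists_prime_of_zariskiDim_realization_eq`).

**Flags.** Running through `P 0, P 1, …` in order and passing, at each `P i ∈ q` outside the current
prime `p ≤ q`, to a prime minimal over `p + (P i)` below `q`, one reaches `q` from `0`. By Krull's
principal ideal theorem and the dimension theory of affine algebras each passage lowers the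
dimension by exactly one, so exactly `m = k - ℓ` of the polynomials are used (`exists_isFlag`).
There are `s.choose m` possible selections, and it remains to see that at most `d ^ m` primes `q`
share the same selection `f₁, …, f_m`.

**Independence.** Let `q_b` be such primes, `g_b` a polynomial lying in all of them but `q_b`, and
`y_b` a set of `ℓ` variables algebraically independent modulo `q_b`. Then the products
`f₁ ^ α₁ ⋯ f_m ^ α_m * g_b * y_b ^ β` are linearly independent over `K`. Modulo `⋂ q_b` this is clear
for the `g_b * y_b ^ β`, and the `fᵢ` are adjoined one at a time along the flags: in a linear
relation the terms of lowest order in `fᵢ` form a relation modulo the next larger primes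
(`IndepMod.pow_mul`, `IndepMod.of_isFlag`).

**Counting.** If `A T` is the number of monomials of degree at most `T` in `k` variables, at least
`A T / d ^ m` pairs `(α, β)` satisfy `d * |α| + |β| ≤ T`, so for `N` primes and `e` bounding the
degrees of the `g_b`, one gets `N * A T ≤ d ^ m * A (T + e)` for all `T`. As `A` grows only
polynomially, `N ≤ d ^ m` (`card_le_pow_of_linearIndependent`). This replaces Bézout's theorem.
-/

open MvPolynomial

/-! ### Krull dimension of affine algebras -/

theorem ringKrullDim_le_of_isIntegral (R S : Type*) [CommRing R] [CommRing S] [Algebra R S]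
    [Algebra.IsIntegral R S] : ringKrullDim S ≤ ringKrullDim R :=
  Order.krullDim_le_of_strictMono (PrimeSpectrum.comap (algebraMap R S)) fun _ _ h =>
    Ideal.IsIntegral.comap_lt_comap h

theorem ringKrullDim_le_of_isIntegral_of_injective (R S : Type*) [CommRing R] [CommRing S]
    [Algebra R S] [Algebra.IsIntegral R S] [FaithfulSMul R S] :
    ringKrullDim R ≤ ringKrullDim S := by
  refine iSup_le fun l => ?_
  obtain ⟨P, hP, hl⟩ := (inferInstance : Nonempty (l.head.asIdeal.primesOver S))
  obtain ⟨L, hL, -⟩ := Ideal.exists_ltSeries_of_hasGoingUp l P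
  rw [← hL]
  exact le_iSup (fun L : LTSeries (PrimeSpectrum S) => (L.length : WithBot ℕ∞)) L

/-- All maximal ideals of a polynomial ring in `n` variables over a field have height `n`. -/
theorem MvPolynomial.height_eq_of_isMaximal {K : Type*} [Field K] (n : ℕ)
    (M : Ideal (MvPolynomial (Fin n) K)) [hM : M.IsMaximal] : M.height = n := by
  induction n with
  | zero =>
    have hF : IsField (MvPolynomial (Fin 0) K) :=
      (isEmptyRingEquiv K (Fin 0)).toMulEquiv.isField (Field.toIsField K)
    let := hF.toField
    rw [(Ideal.eq_bot_or_top M).resolve_right hM.ne_top, Ideal.height_bot, Nat.cast_zero]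
  | succ n ih =>
    let e := (finSuccEquiv K n).toRingEquiv
    let M' := M.comap e.symm
    have : M'.IsMaximal := Ideal.comap_isMaximal_of_equiv e.symm
    have : (M'.comap (Polynomial.C : MvPolynomial (Fin n) K →+* _)).IsMaximal :=
      Polynomial.isMaximal_comap_C_of_isJacobsonRing M'
    have : M'.LiesOver (M'.comap (Polynomial.C : MvPolynomial (Fin n) K →+* _)) := ⟨rfl⟩
    rw [← RingEquiv.height_comap e.symm M,
      Polynomial.height_eq_height_add_one (M'.comap Polynomial.C) M', ih]
    rfl

theorem MvPolynomial.le_ringKrullDim_quotient_span_add_one {K : Type*} [Field K] {n : ℕ}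
    {f : MvPolynomial (Fin n) K} (hf : ¬ IsUnit f) :
    (n : WithBot ℕ∞) ≤ ringKrullDim (MvPolynomial (Fin n) K ⧸ Ideal.span {f}) + 1 := by
  obtain ⟨M, hM, hfM⟩ := exists_max_ideal_of_mem_nonunits hf
  have := Ideal.height_le_ringKrullDim_quotient_add_one hfM
  rwa [MvPolynomial.height_eq_of_isMaximal] at this

/-- In an affine domain the quotient by a prime of height one has dimension exactly one less.
By Noether normalization and going down, the prime lies over a height one prime of a polynomial
ring, which is principal; there the heights of the maximal ideals give the bound. -/
theorem ringKrullDim_eq_ringKrullDim_quotient_add_one (K : Type*) {A : Type*} [Field K]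
    [CommRing A] [IsDomain A] [Algebra K A] [Algebra.FiniteType K A]
    (p : Ideal A) [p.IsPrime] (hp : p ≠ ⊥) (hp1 : p.height ≤ 1) :
    ringKrullDim A = ringKrullDim (A ⧸ p) + 1 := by
  apply le_antisymm
  · obtain ⟨n, g, hg, hgi⟩ := exists_integral_inj_algHom_of_fg K A
    algebraize [g.toRingHom]
    have : Algebra.IsIntegral (MvPolynomial (Fin n) K) A := ⟨hgi⟩
    have : FaithfulSMul (MvPolynomial (Fin n) K) A :=
      (faithfulSMul_iff_algebraMap_injective _ _).mpr hg
    have : IsNoetherianRing A := Algebra.FiniteType.isNoetherianRing K A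
    set p0 := p.under (MvPolynomial (Fin n) K) with hp0
    have h0 : p0 ≠ ⊥ := Ideal.IsIntegral.comap_ne_bot _ hp
    obtain ⟨f, hf, hfp⟩ := Ideal.IsPrime.exists_mem_prime_of_ne_bot
      (inferInstance : p0.IsPrime) h0
    have h1 : p0.height = 1 := by
      apply le_antisymm
      · refine le_trans ?_ hp1
        rw [Ideal.height_eq_height_add_of_liesOver_of_hasGoingDown p0 p]
        exact le_self_add
      · rw [Order.one_le_iff_ne_zero]
        exact fun h => h0 (Ideal.height_eq_zero_iff_eq_bot.mp h)
    have h2 := Ideal.eq_span_singleton_of_height_eq_one h1 hf hfp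
    calc ringKrullDim A ≤ ringKrullDim (MvPolynomial (Fin n) K) :=
          ringKrullDim_le_of_isIntegral _ _
      _ = n := by simp
      _ ≤ ringKrullDim (MvPolynomial (Fin n) K ⧸ p0) + 1 := by
          rw [h2]; exact le_ringKrullDim_quotient_span_add_one hfp.not_isUnit
      _ ≤ _ := by
          gcongr
          have : FaithfulSMul (MvPolynomial (Fin n) K ⧸ p0) (A ⧸ p) :=
            (faithfulSMul_iff_algebraMap_injective _ _).mpr
              (Ideal.algebraMap_quotient_injective (I := p))
          exact ringKrullDim_le_of_isIntegral_of_injective _ _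
  · obtain ⟨x, hx, hx0⟩ := Submodule.exists_mem_ne_zero_of_ne_bot hp
    refine le_trans ?_ (ringKrullDim_quotient_succ_le_of_nonZeroDivisor
      (mem_nonZeroDivisors_of_ne_zero hx0))
    gcongr
    exact ringKrullDim_le_of_surjective (Ideal.Quotient.factor
      ((Ideal.span_singleton_le_iff_mem p).mpr hx)) (Ideal.Quotient.factor_surjective _)

/-- A minimal prime over `p + (f)`, for `f ∉ p`, cuts the dimension down by exactly one: the
geometric form of the principal ideal theorem for affine algebras. -/
theorem ringKrullDim_quotient_eq_of_mem_minimalPrimes (K : Type*) {A : Type*} [Field K]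
    [CommRing A] [Algebra K A] [Algebra.FiniteType K A] {p p' : Ideal A} [p.IsPrime] {f : A}
    (hf : f ∉ p) (hp' : p' ∈ (p ⊔ Ideal.span {f}).minimalPrimes) :
    ringKrullDim (A ⧸ p) = ringKrullDim (A ⧸ p') + 1 := by
  have : IsNoetherianRing A := Algebra.FiniteType.isNoetherianRing K A
  have hle : p ≤ p' := le_sup_left.trans hp'.le
  have hfp' : f ∈ p' := hp'.le (le_sup_right (a := p) (Ideal.mem_span_singleton_self f))
  have := hp'.isPrime
  have : (p'.map (Ideal.Quotient.mk p)).IsPrime := Ideal.isPrime_map_quotientMk_of_isPrime hle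
  rw [ringKrullDim_eq_ringKrullDim_quotient_add_one K (p'.map (Ideal.Quotient.mk p)) ?_
    (Ideal.map_height_le_one_of_mem_minimalPrimes hp'),
    ringKrullDim_eq_of_ringEquiv (DoubleQuot.quotQuotEquivQuotOfLE hle)]
  intro h
  exact hf (Ideal.Quotient.eq_zero_iff_mem.mp
    ((Submodule.mem_bot _).mp (h ▸ Ideal.mem_map_of_mem (Ideal.Quotient.mk p) hfp')))

/-- If `R ⧸ q` has dimension `l`, then some `l` of the variables are algebraically independent
modulo `q`: a transcendence basis can be chosen among the generators, and Noether normalization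
bounds the dimension by the transcendence degree. -/
theorem MvPolynomial.exists_algebraicIndependent_X_of_ringKrullDim_eq {K : Type*} [Field K]
    {k l : ℕ} (q : Ideal (MvPolynomial (Fin k) K)) [q.IsPrime]
    (hq : ringKrullDim (MvPolynomial (Fin k) K ⧸ q) = l) :
    ∃ σ : Fin l → Fin k,
      AlgebraicIndependent K fun i => Ideal.Quotient.mkₐ K q (X (σ i)) := by
  set A := MvPolynomial (Fin k) K ⧸ q
  obtain ⟨n, g, hg, hgi⟩ := exists_integral_inj_algHom_of_fg K A
  have hln : l ≤ n := by
    algebraize [g.toRingHom]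
    have : Algebra.IsIntegral (MvPolynomial (Fin n) K) A := ⟨hgi⟩
    have := ringKrullDim_le_of_isIntegral (MvPolynomial (Fin n) K) A
    rw [hq] at this
    simpa using this
  have htr : (n : Cardinal) ≤ Algebra.trdeg K A := by
    have := lift_trdeg_le_of_injective g hg
    simpa using this
  set x : Fin k → A := fun i => Ideal.Quotient.mkₐ K q (X i) with hx
  have htop : Algebra.adjoin K (Set.range x) = ⊤ := by
    have : Set.range x = Ideal.Quotient.mkₐ K q '' Set.range X := by
      rw [← Set.range_comp]; rfl
    rw [this, ← AlgHom.map_adjoin, adjoin_range_X, Algebra.map_top,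
      AlgHom.range_eq_top]
    exact Ideal.Quotient.mkₐ_surjective K q
  have : Algebra.IsAlgebraic (Algebra.adjoin K (Set.range x)) A := by
    rw [htop]
    exact ⟨fun a => isAlgebraic_algebraMap (⟨a, trivial⟩ : (⊤ : Subalgebra K A))⟩
  obtain ⟨t, ht, hb⟩ := exists_isTranscendenceBasis_subset (R := K) (Set.range x)
  have hcard : Cardinal.lift (Cardinal.mk (Fin l)) ≤ Cardinal.mk t := by
    rw [hb.cardinalMk_eq_trdeg]
    refine le_trans ?_ htr
    simpa using hln
  rw [← Cardinal.lift_id (Cardinal.mk t)] at hcard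
  obtain ⟨e⟩ := Cardinal.lift_mk_le'.mp (by simpa using hcard :
    Cardinal.lift (Cardinal.mk (Fin l)) ≤ Cardinal.lift.{0} (Cardinal.mk t))
  choose σ hσ using fun i => ht (e i).2
  refine ⟨σ, ?_⟩
  have h := hb.1.comp e e.injective
  convert! h using 1
  funext i
  exact hσ i

/-- The dimension of `R ⧸ I` is attained on an irreducible component. -/
theorem exists_mem_minimalPrimes_ringKrullDim_eq {R : Type*} [CommRing R] {I : Ideal R} {l : ℕ}
    (h : ringKrullDim (R ⧸ I) = l) : ∃ q ∈ I.minimalPrimes, ringKrullDim (R ⧸ q) = l := by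
  have h' := h
  rw [ringKrullDim_quotient] at h'
  obtain ⟨s, hs⟩ := Order.le_krullDim_iff.mp h'.ge
  obtain ⟨q, hq, hle⟩ := Ideal.exists_minimalPrimes_le (J := s.head.1.asIdeal) s.head.2
  refine ⟨q, hq, le_antisymm ?_ ?_⟩
  · rw [← h]
    exact ringKrullDim_le_of_surjective (Ideal.Quotient.factor hq.le)
      (Ideal.Quotient.factor_surjective _)
  · rw [ringKrullDim_quotient, Order.le_krullDim_iff]
    exact ⟨⟨s.length, fun i => ⟨(s i).1, fun x hx => s.monotone (Fin.zero_le i) (hle hx)⟩,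
      fun i => s.step i⟩, hs⟩

theorem le_of_le_of_ringKrullDim_eq (K : Type*) {R : Type*} [Field K] [CommRing R] [Algebra K R]
    [Algebra.FiniteType K R] {p q : Ideal R} [p.IsPrime] [q.IsPrime] {l : ℕ} (hpq : p ≤ q)
    (hp : ringKrullDim (R ⧸ p) = l) (hq : ringKrullDim (R ⧸ q) = l) : q ≤ p := by
  intro f hf
  by_contra hfp
  obtain ⟨p', hp', hle⟩ := Ideal.exists_minimalPrimes_le
    (sup_le hpq ((Ideal.span_singleton_le_iff_mem q).mpr hf))
  have h1 := ringKrullDim_quotient_eq_of_mem_minimalPrimes K hfp hp'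
  have h2 : ringKrullDim (R ⧸ q) ≤ ringKrullDim (R ⧸ p') :=
    ringKrullDim_le_of_surjective (Ideal.Quotient.factor hle) (Ideal.Quotient.factor_surjective _)
  have h3 : (l : WithBot ℕ∞) + 1 ≤ l := by
    calc (l : WithBot ℕ∞) + 1 ≤ ringKrullDim (R ⧸ p') + 1 := by
          rw [← hq]; gcongr
      _ = l := by rw [← h1, hp]
  have : l + 1 ≤ l := by exact_mod_cast h3
  omega

/-! ### Linear independence along flags of primes -/

/-- The family `u` of elements of the `K`-algebra `R` is linearly independent over `K` modulo the
ideal `I`. -/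
def IndepMod (K : Type*) {R ι : Type*} [Field K] [CommRing R] [Algebra K R] (I : Ideal R)
    (u : ι → R) : Prop :=
  ∀ c : ι →₀ K, Finsupp.linearCombination K u c ∈ I → c = 0

section

variable {K R ι κ : Type*} [Field K] [CommRing R] [Algebra K R]

theorem IndepMod.comp {I : Ideal R} {u : ι → R} (hu : IndepMod K I u) {e : κ → ι}
    (he : Function.Injective e) : IndepMod K I (u ∘ e) := by
  intro c hc
  rw [← Finsupp.linearCombination_mapDomain] at hc
  exact Finsupp.mapDomain_injective he ((hu _ hc).trans Finsupp.mapDomain_zero.symm)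

/-- Grouping a linear combination of products `w a * u a i` by the first index. -/
theorem linearCombination_prod (w : κ → R) (u : κ → ι → R) (C : κ × ι →₀ K) :
    Finsupp.linearCombination K (fun x : κ × ι => w x.1 * u x.1 x.2) C =
      ∑ a ∈ C.curry.support, w a * Finsupp.linearCombination K (u a) (C.curry a) := by
  rw [Finsupp.linearCombination_apply,
    ← Finsupp.sum_curry_index C (fun a i c => c • (w a * u a i))]
  refine Finset.sum_congr rfl fun a _ => ?_
  rw [Finsupp.linearCombination_apply, Finsupp.mul_sum]
  exact Finset.sum_congr rfl fun i _ => (mul_smul_comm _ _ _).symm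

/-- If `u` is independent modulo `I'`, and `f ∈ I'` is a nonzerodivisor modulo the smaller ideal
`I`, then the products `f ^ a * u i` are independent modulo `I`: after division by the lowest power
of `f` that occurs in a relation, its lowest terms form a relation modulo `I'`. -/
theorem IndepMod.pow_mul {I I' : Ideal R} {f : R} (hI : I ≤ I') (hf : f ∈ I')
    (hfI : ∀ x, f * x ∈ I → x ∈ I) {u : ι → R} (hu : IndepMod K I' u) :
    IndepMod K I fun x : ℕ × ι => f ^ x.1 * u x.2 := by
  intro C hC
  by_contra hne
  have hD : C.curry.support.Nonempty := by
    rw [Finsupp.support_nonempty_iff]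
    intro h
    exact hne (Finsupp.curryEquiv.injective (h.trans (Finsupp.ext fun _ => rfl)))
  rw [linearCombination_prod (fun a => f ^ a) (fun _ => u)] at hC
  set D := C.curry
  -- the lowest power of `f` with a nonzero coefficient
  set a := D.support.min' hD
  have ha : a ∈ D.support := Finset.min'_mem _ _
  have hpow : ∀ (n : ℕ) (x : R), f ^ n * x ∈ I → x ∈ I := by
    intro n
    induction n with
    | zero => simp
    | succ n ih => exact fun x h => ih x (hfI _ (by rwa [pow_succ', mul_assoc] at h))
  have hfac : ∑ b ∈ D.support, f ^ b * Finsupp.linearCombination K u (D b) =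
      f ^ a * ∑ b ∈ D.support, f ^ (b - a) * Finsupp.linearCombination K u (D b) := by
    rw [Finset.mul_sum]
    refine Finset.sum_congr rfl fun b hb => ?_
    rw [← mul_assoc, ← pow_add, Nat.add_sub_cancel' (Finset.min'_le _ _ hb)]
  rw [hfac] at hC
  have h1 := hI (hpow _ _ hC)
  rw [← Finset.add_sum_erase _ _ ha, Nat.sub_self, pow_zero, one_mul] at h1
  have h2 : ∑ b ∈ D.support.erase a, f ^ (b - a) * Finsupp.linearCombination K u (D b) ∈ I' := by
    refine Ideal.sum_mem _ fun b hb => ?_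
    have hlt : a < b := lt_of_le_of_ne (Finset.min'_le _ _ (Finset.mem_of_mem_erase hb))
      (Finset.ne_of_mem_erase hb).symm
    exact I'.mul_mem_right _ (I'.pow_mem_of_mem hf _ (Nat.sub_pos_of_lt hlt))
  exact Finsupp.mem_support_iff.mp ha (hu _ ((Ideal.add_mem_iff_left _ h2).mp h1))

/-- `IsFlag q p [f₁, …, f_m]` says that there is a chain `p = p₀ ≤ p₁ ≤ ⋯ ≤ p_m = q` of ideals with
`fᵢ ∈ pᵢ` and `fᵢ ∉ pᵢ₋₁` for all `i`, in which `p₀, …, p_{m-1}` are prime. Nothing is asked of `q`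
itself, which is prime wherever the notion is used. -/
def IsFlag (q : Ideal R) : Ideal R → List R → Prop
  | p, [] => p = q
  | p, f :: L => p.IsPrime ∧ ∃ p', p ≤ p' ∧ f ∈ p' ∧ f ∉ p ∧ IsFlag q p' L

theorem IsFlag.le {q p : Ideal R} {L : List R} (h : IsFlag q p L) : p ≤ q := by
  induction L generalizing p with
  | nil => exact le_of_eq h
  | cons f L ih =>
    obtain ⟨-, p', hle, -, -, h'⟩ := h
    exact hle.trans (ih h')

/-- Independence is transported from the ends `q b` of a family of flags through the same elements
`L` to their beginnings `p b`, at the gain of all monomials in `L`. -/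
theorem IndepMod.of_isFlag {B : Type*} (L : List R) {q p : B → Ideal R}
    (h : ∀ b, IsFlag (q b) (p b) L) {u : ι → R} (hu : IndepMod K (⨅ b, q b) u) :
    IndepMod K (⨅ b, p b)
      fun x : (Fin L.length → ℕ) × ι => (∏ i, L.get i ^ x.1 i) * u x.2 := by
  induction L generalizing p with
  | nil =>
    obtain rfl : p = q := funext h
    have := hu.comp (e := fun x : (Fin 0 → ℕ) × ι => x.2)
      fun x y hxy => Prod.ext (Subsingleton.elim _ _) hxy
    convert! this using 1
    funext x
    simp
  | cons f L ih =>
    -- the first element of the flag is adjoined last; it is a nonzerodivisor modulo `⨅ b, p b`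
    -- because it lies in none of the primes `p b`
    choose hp p' hle hf hf' hflag using h
    have step := (ih hflag).pow_mul (I := ⨅ b, p b) (iInf_mono hle)
      ((Ideal.mem_iInf).mpr hf) fun x hx => Ideal.mem_iInf.mpr fun b =>
        ((hp b).mem_or_mem (Ideal.mem_iInf.mp hx b)).resolve_left (hf' b)
    have := step.comp (e := fun x : (Fin (L.length + 1) → ℕ) × ι => (x.1 0, (Fin.tail x.1, x.2)))
      fun x y hxy => by
        simp only [Prod.mk.injEq] at hxy
        refine Prod.ext ?_ hxy.2.2
        rw [← Fin.cons_self_tail x.1, ← Fin.cons_self_tail y.1, hxy.1, hxy.2.1]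
    convert! this using 1
    funext x
    simp only [Function.comp]
    rw [← mul_assoc]
    congr 1
    exact Fin.prod_univ_succ _

end

/-- Let `g b` lie in every `q a` with `a ≠ b` but not in `q b`, and let the `y b i` be algebraically
independent modulo `q b`. Then the products of `g b` with the monomials in `y b` are independent
modulo the intersection of the `q b`. -/
theorem indepMod_iInf_of_algebraicIndependent {K σ B τ : Type*} [Field K] [Finite B]
    (q : B → Ideal (MvPolynomial σ K)) (hq : ∀ b, (q b).IsPrime)
    (g : B → MvPolynomial σ K) (hg : ∀ b, g b ∉ q b) (hg' : ∀ a b, a ≠ b → g a ∈ q b)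
    (y : B → τ → MvPolynomial σ K)
    (hy : ∀ b, AlgebraicIndependent K fun i => Ideal.Quotient.mkₐ K (q b) (y b i)) :
    IndepMod K (⨅ b, q b)
      fun x : B × (τ →₀ ℕ) => g x.1 * aeval (y x.1) (monomial x.2 (1 : K)) := by
  classical
  intro C hC
  rw [linearCombination_prod g (fun b β => aeval (y b) (monomial β (1 : K)))] at hC
  apply Finsupp.curryEquiv.injective
  refine Finsupp.ext fun b => ?_
  change C.curry b = 0
  by_contra hb
  have h1 := Ideal.mem_iInf.mp hC b
  rw [← Finset.add_sum_erase _ _ (Finsupp.mem_support_iff.mpr hb), Ideal.add_mem_iff_left] at h1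
  · have h2 := ((hq b).mem_or_mem h1).resolve_left (hg b)
    have h3 : Finsupp.linearCombination K (fun β => aeval (y b) (monomial β (1 : K))) (C.curry b)
        = aeval (y b) (Finsupp.linearCombination K
            (fun β => monomial β (1 : K)) (C.curry b)) := by
      rw [Finsupp.linearCombination_apply, Finsupp.linearCombination_apply, map_finsuppSum]
      simp only [map_smul]
    rw [h3, ← Ideal.Quotient.eq_zero_iff_mem] at h2
    have h4 : aeval (fun i => Ideal.Quotient.mkₐ K (q b) (y b i)) (Finsupp.linearCombination K
            (fun β => monomial β (1 : K)) (C.curry b)) = 0 := by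
      rw [← h2]
      exact (comp_aeval_apply (y b) (Ideal.Quotient.mkₐ K (q b)) _).symm
    have h5 := (injective_iff_map_eq_zero _).mp (hy b) _ h4
    exact hb ((linearIndependent_iff.mp (basisMonomials τ K).linearIndependent) _
      (by simpa using h5))
  · exact Ideal.sum_mem _ fun a ha =>
      Ideal.mul_mem_right _ _ (hg' a b (Finset.ne_of_mem_erase ha))

/-! ### Existence of flags -/

/-- The greedy flag: if `q` is minimal over the ideal of the `P i` it contains, then some of the
`P i`, taken in the order of `L`, form a flag from `p` to `q`, one for each unit of the difference of
the dimensions. Taking the indices in a fixed order makes the flag depend on a set of indices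
only. -/
theorem exists_isFlag (K : Type*) {R : Type*} [Field K] [CommRing R] [Algebra K R]
    [Algebra.FiniteType K R] {ι : Type*} (P : ι → R) {q : Ideal R} [q.IsPrime]
    (hq : q ∈ (Ideal.span {x | ∃ i, P i = x ∧ x ∈ q}).minimalPrimes) (L : List ι)
    {p : Ideal R} (hp : p.IsPrime) (hpq : p ≤ q) (hL : ∀ i, P i ∈ q → i ∈ L ∨ P i ∈ p) :
    ∃ L' : List ι, L'.Sublist L ∧ IsFlag q p (L'.map P) ∧
      ringKrullDim (R ⧸ p) = ringKrullDim (R ⧸ q) + L'.length := by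
  induction L generalizing p with
  | nil =>
    -- `p` contains every `P i` in `q`, so that it equals `q` by minimality
    obtain rfl : p = q := le_antisymm hpq <| hq.2 ⟨hp, Ideal.span_le.mpr <| by
      rintro x ⟨i, rfl, hi⟩
      simpa using hL i hi⟩ hpq
    exact ⟨[], .refl _, rfl, by simp⟩
  | cons i L ih =>
    by_cases hi : P i ∈ q ∧ P i ∉ p
    · obtain ⟨p', hp', hle⟩ := Ideal.exists_minimalPrimes_le
        (sup_le hpq ((Ideal.span_singleton_le_iff_mem q).mpr hi.1))
      have hpp' : p ≤ p' := le_sup_left.trans hp'.le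
      have hmem : P i ∈ p' := hp'.le (le_sup_right (a := p) (Ideal.mem_span_singleton_self _))
      obtain ⟨L', hs, hf, hdim⟩ := ih hp'.isPrime hle fun j hj => by
        rcases hL j hj with h | h
        · rcases List.mem_cons.mp h with rfl | h
          · exact .inr hmem
          · exact .inl h
        · exact .inr (hpp' h)
      refine ⟨i :: L', hs.cons_cons i, ⟨hp, p', hpp', hmem, hi.2, hf⟩, ?_⟩
      rw [ringKrullDim_quotient_eq_of_mem_minimalPrimes K hi.2 hp', hdim, add_assoc]
      simp
    · obtain ⟨L', hs, hf, hdim⟩ := ih hp hpq fun j hj => by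
        rcases hL j hj with h | h
        · rcases List.mem_cons.mp h with rfl | h
          · exact .inr (by tauto)
          · exact .inl h
        · exact .inr h
      exact ⟨L', hs.cons i, hf, hdim⟩

/-! ### Counting monomials -/

theorem finite_degree_le (k T : ℕ) : Finite {n : Fin k →₀ ℕ // n.degree ≤ T} := by
  refine Finite.of_injective
    (fun n (i : Fin k) => (⟨n.1 i, Nat.lt_succ_of_le ((Finsupp.le_degree i n.1).trans n.2)⟩ :
      Fin (T + 1))) fun a b h => ?_
  exact Subtype.ext (Finsupp.ext fun i => congrArg Fin.val (congrFun h i))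

theorem card_degree_le_pow (k T : ℕ) :
    Nat.card {n : Fin k →₀ ℕ // n.degree ≤ T} ≤ (T + 1) ^ k := by
  have := Nat.card_le_card_of_injective
    (fun (n : {n : Fin k →₀ ℕ // n.degree ≤ T}) (i : Fin k) =>
      (⟨n.1 i, Nat.lt_succ_of_le ((Finsupp.le_degree i n.1).trans n.2)⟩ : Fin (T + 1)))
    fun a b h => Subtype.ext (Finsupp.ext fun i => congrArg Fin.val (congrFun h i))
  simpa using this

theorem finite_and_card_le_card_degree_le_of_linearIndependent {K ι : Type*} [Field K] {k T : ℕ}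
    {u : ι → MvPolynomial (Fin k) K} (hu : LinearIndependent K u)
    (hdeg : ∀ x, (u x).totalDegree ≤ T) :
    Finite ι ∧ Nat.card ι ≤ Nat.card {n : Fin k →₀ ℕ // n.degree ≤ T} := by
  have hb : Module.finrank K (restrictTotalDegree (Fin k) K T) =
      Nat.card {n : Fin k →₀ ℕ // n.degree ≤ T} :=
    Module.finrank_eq_nat_card_basis (basisRestrictSupport K _)
  let u' : ι → restrictTotalDegree (Fin k) K T := fun x =>
    ⟨u x, (mem_restrictTotalDegree _ _ _).mpr (hdeg x)⟩
  have hu' : LinearIndependent K u' :=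
    LinearIndependent.of_comp (restrictTotalDegree (Fin k) K T).subtype hu
  have : Finite ι := hu'.finite
  have := Fintype.ofFinite ι
  refine ⟨this.finite, ?_⟩
  rw [← hb, Nat.card_eq_fintype_card]
  exact hu'.fintype_card_le_finrank

/-- If `a` is polynomially bounded and `N * a T ≤ D * a (T + e)` for all `T`, then `N ≤ D`, since
otherwise `a (n * e) ≥ (N / D) ^ n` would grow exponentially. -/
theorem le_of_forall_mul_le_mul {N D e k : ℕ} {a : ℕ → ℕ} (h0 : 0 < a 0)
    (ha : ∀ T, a T ≤ (T + 1) ^ k) (h : ∀ T, N * a T ≤ D * a (T + e)) : N ≤ D := by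
  by_contra! hlt
  have key : ∀ n, N ^ n ≤ D ^ n * a (n * e) := by
    intro n
    induction n with
    | zero => simpa using Nat.succ_le_of_lt h0
    | succ n ih =>
      calc N ^ (n + 1) = N * N ^ n := pow_succ' _ _
        _ ≤ N * (D ^ n * a (n * e)) := Nat.mul_le_mul_left _ ih
        _ = D ^ n * (N * a (n * e)) := by ring
        _ ≤ D ^ n * (D * a (n * e + e)) := Nat.mul_le_mul_left _ (h _)
        _ = D ^ (n + 1) * a ((n + 1) * e) := by rw [Nat.succ_mul]; ring
  rcases Nat.eq_zero_or_pos D with rfl | hD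
  · have := key 1
    simp at this
    omega
  set r : ℝ := (N : ℝ) / D with hr
  have hD' : (0 : ℝ) < D := by exact_mod_cast hD
  have hr1 : 1 < r := by
    rw [hr, one_lt_div hD']
    exact_mod_cast hlt
  have hlim := (tendsto_pow_const_div_const_pow_of_one_lt k hr1).const_mul ((e + 2 : ℝ) ^ k)
  rw [mul_zero] at hlim
  obtain ⟨n, hn, hn1⟩ := ((hlim.eventually_lt_const one_pos).and
    (Filter.eventually_ge_atTop 1)).exists
  have hrn : 0 < r ^ n := by positivity
  rw [← mul_div_assoc, div_lt_one hrn, ← mul_pow] at hn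
  have h1 : r ^ n ≤ ((n * e + 1 : ℕ) : ℝ) ^ k := by
    rw [hr, div_pow, div_le_iff₀ (by positivity), mul_comm]
    exact_mod_cast (key n).trans (Nat.mul_le_mul_left _ (ha _))
  refine absurd (h1.trans (pow_le_pow_left₀ (by positivity) ?_ k)) (not_le.mpr hn)
  have : (1 : ℝ) ≤ n := by exact_mod_cast hn1
  push_cast
  nlinarith

/-- The counting argument: linear independence of all `f ^ α * v (b, β)` in degrees at most `T + e`,
for `T → ∞`, bounds the number of the `b`. -/
theorem card_le_pow_of_linearIndependent {K B : Type*} [Field K] [Finite B] {k l m d e : ℕ}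
    (hk : l + m = k) (hd : m = 0 ∨ 0 < d) {f : Fin m → MvPolynomial (Fin k) K}
    (hf : ∀ i, (f i).totalDegree ≤ d) {v : B × (Fin l →₀ ℕ) → MvPolynomial (Fin k) K}
    (hv : ∀ x, (v x).totalDegree ≤ e + x.2.degree)
    (h : LinearIndependent K
      fun x : (Fin m → ℕ) × B × (Fin l →₀ ℕ) => (∏ i, f i ^ x.1 i) * v x.2) :
    Nat.card B ≤ d ^ m := by
  refine le_of_forall_mul_le_mul (e := e) (k := k)
    (a := fun T => Nat.card {n : Fin k →₀ ℕ // n.degree ≤ T}) ?_ (card_degree_le_pow k)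
    fun T => ?_
  · have := finite_degree_le k 0
    exact Nat.card_pos_iff.mpr ⟨⟨0, by simp⟩, this⟩
  -- the products that are visibly of degree at most `T + e`
  let E := {x : (Fin m → ℕ) × B × (Fin l →₀ ℕ) // (∑ i, d * x.1 i) + x.2.2.degree ≤ T}
  have hE := finite_and_card_le_card_degree_le_of_linearIndependent (T := T + e)
    (h.comp (Subtype.val : E → _) Subtype.val_injective) fun x => by
      refine (totalDegree_mul _ _).trans ?_
      have h1 := hv x.1.2
      have h2 : (∏ i, f i ^ x.1.1 i).totalDegree ≤ ∑ i, d * x.1.1 i :=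
        (totalDegree_finsetProd _ _).trans (Finset.sum_le_sum fun i _ =>
          (totalDegree_pow _ _).trans (by rw [mul_comm]; exact Nat.mul_le_mul_right _ (hf i)))
      have h3 := x.2
      omega
  obtain ⟨hfin, hcard⟩ := hE
  let s : Fin l ⊕ Fin m ≃ Fin k := finSumFinEquiv.trans (finCongr hk)
  have hdm : ∀ i : Fin m, 0 < d := fun i => hd.resolve_left (Nat.ne_zero_of_lt i.2)
  have hdeg : ∀ γ : Fin k →₀ ℕ, γ.degree = ∑ j, γ (s (.inl j)) + ∑ i, γ (s (.inr i)) := by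
    intro γ
    rw [Finsupp.degree_eq_sum, ← Equiv.sum_comp s, Fintype.sum_sum_type]
  -- Division with remainder by `d` of the exponents at `m` of the places shows that the number of
  -- pairs `(α, β)` with `d * |α| + |β| ≤ T` is at least `d ^ (-m)` times the number of monomials.
  let Φ : B × {n : Fin k →₀ ℕ // n.degree ≤ T} → (Fin m → Fin d) × E := fun x =>
    (fun i => ⟨x.2.1 (s (.inr i)) % d, Nat.mod_lt _ (hdm i)⟩,
     ⟨(fun i => x.2.1 (s (.inr i)) / d, x.1,
        Finsupp.equivFunOnFinite.symm fun j => x.2.1 (s (.inl j))), by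
      have h1 := x.2.2
      rw [hdeg] at h1
      rw [Finsupp.degree_eq_sum]
      have h2 : ∑ i, d * (x.2.1 (s (.inr i)) / d) ≤ ∑ i, x.2.1 (s (.inr i)) :=
        Finset.sum_le_sum fun i _ => Nat.mul_div_le _ _
      simp only [Finsupp.equivFunOnFinite_symm_apply_apply]
      omega⟩)
  have hΦ : Function.Injective Φ := by
    rintro ⟨b, γ, hγ⟩ ⟨b', γ', hγ'⟩ heq
    obtain ⟨h1, h⟩ := Prod.ext_iff.mp heq
    obtain ⟨h2, h⟩ := Prod.ext_iff.mp (Subtype.ext_iff.mp h)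
    obtain ⟨h3, h4⟩ := Prod.ext_iff.mp h
    refine Prod.ext h3 (Subtype.ext (Finsupp.ext fun a => ?_))
    obtain ⟨a, rfl⟩ := s.surjective a
    rcases a with j | i
    · exact DFunLike.congr_fun h4 j
    · have h5 := congrArg Fin.val (congrFun h1 i)
      have h6 := congrFun h2 i
      change γ _ = γ' _
      rw [← Nat.div_add_mod (γ (s (.inr i))) d, ← Nat.div_add_mod (γ' (s (.inr i))) d]
      simp only [Φ] at h5 h6
      rw [h5, h6]
  have := Nat.card_le_card_of_injective Φ hΦ
  rw [Nat.card_prod, Nat.card_prod] at this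
  refine this.trans ?_
  have hc : Nat.card (Fin m → Fin d) = d ^ m := by simp
  rw [hc]
  exact Nat.mul_le_mul_left _ hcard

/-! ### Primes with a common flag -/

theorem totalDegree_aeval_X_monomial_le {K σ τ : Type*} [Field K] (s : τ → σ) (β : τ →₀ ℕ) :
    (aeval (fun i => (X (s i) : MvPolynomial σ K)) (monomial β (1 : K))).totalDegree
      ≤ β.degree := by
  rw [aeval_monomial, map_one, one_mul]
  refine (totalDegree_finsetProd _ _).trans (Finset.sum_le_sum fun i _ => ?_)
  refine (totalDegree_pow _ _).trans ?_
  rw [totalDegree_X, mul_one]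

/-- Constants cannot occur in a flag from `⊥` to a prime, so that the case `d = 0` is trivial. -/
theorem IsFlag.length_eq_zero_or_pos {K σ : Type*} [Field K] {d : ℕ} {q : Ideal (MvPolynomial σ K)}
    (hq : q.IsPrime) {L : List (MvPolynomial σ K)} (hL : ∀ f ∈ L, f.totalDegree ≤ d)
    (h : IsFlag q ⊥ L) : L.length = 0 ∨ 0 < d := by
  rcases L with _ | ⟨f, L⟩
  · exact .inl rfl
  refine .inr (Nat.pos_of_ne_zero ?_)
  rintro rfl
  obtain ⟨-, p', -, hf, hf0, hfl⟩ := h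
  have hC := totalDegree_eq_zero_iff_eq_C.mp (Nat.le_zero.mp (hL f (by simp)))
  have hc : coeff 0 f ≠ 0 := fun h0 => hf0 (by rw [hC, h0]; simp)
  have hu : IsUnit f := by
    rw [hC]
    exact (isUnit_iff_ne_zero.mpr hc).map C
  exact hq.ne_top (Ideal.eq_top_of_isUnit_mem _ (hfl.le hf) hu)

/-- Among finitely many pairwise incomparable primes, each misses some element of the
intersection of the others. -/
theorem exists_notMem_and_forall_mem {R B : Type*} [CommRing R] [Finite B] (q : B → Ideal R)
    (hq : ∀ b, (q b).IsPrime) (hne : ∀ a b, q a ≤ q b → a = b) (b : B) :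
    ∃ g, g ∉ q b ∧ ∀ a, a ≠ b → g ∈ q a := by
  classical
  have := Fintype.ofFinite B
  by_contra! h
  have hle : (Finset.univ.erase b).inf q ≤ q b := by
    intro g hg
    by_contra hgb
    obtain ⟨a, hab, hga⟩ := h g hgb
    exact hga (Finset.inf_le (f := q) (Finset.mem_erase.mpr ⟨hab, Finset.mem_univ a⟩) hg)
  obtain ⟨a, ha, hle⟩ := (hq b).inf_le'.mp hle
  exact Finset.ne_of_mem_erase ha (hne a b hle)

/-- At most `d ^ m` primes of the same dimension are ends of flags through the same `m` polynomials
of degree at most `d`. -/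
theorem card_le_pow_of_isFlag {K B : Type*} [Field K] [Finite B] {k l d : ℕ}
    (q : B → Ideal (MvPolynomial (Fin k) K)) (hq : ∀ b, (q b).IsPrime)
    (hinj : Function.Injective q)
    (hdim : ∀ b, ringKrullDim (MvPolynomial (Fin k) K ⧸ q b) = l)
    {L : List (MvPolynomial (Fin k) K)} (hL : ∀ f ∈ L, f.totalDegree ≤ d)
    (hk : l + L.length = k) (hflag : ∀ b, IsFlag (q b) ⊥ L) :
    Nat.card B ≤ d ^ L.length := by
  rcases isEmpty_or_nonempty B with hB | hB
  · simp
  have := Fintype.ofFinite B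
  choose g hgq hgq' using exists_notMem_and_forall_mem q hq fun a b hle =>
    hinj (le_antisymm hle (le_of_le_of_ringKrullDim_eq K hle (hdim a) (hdim b)))
  choose σ hσ using fun b => exists_algebraicIndependent_X_of_ringKrullDim_eq (q b) (hdim b)
  have hind := (indepMod_iInf_of_algebraicIndependent q hq g hgq (fun a b hab => hgq' a b hab.symm)
    (fun b i => X (σ b i)) hσ).of_isFlag L hflag
  rw [iInf_const] at hind
  have hli := linearIndependent_iff.mpr fun c hc => hind c ((Submodule.mem_bot _).mpr hc)
  have hv : ∀ x : B × (Fin l →₀ ℕ), (g x.1 * aeval (fun i => (X (σ x.1 i) :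
      MvPolynomial (Fin k) K)) (monomial x.2 (1 : K))).totalDegree ≤
      (Finset.univ.sup fun b => (g b).totalDegree) + x.2.degree := fun x =>
    (totalDegree_mul _ _).trans (add_le_add
      (Finset.le_sup (f := fun b => (g b).totalDegree) (Finset.mem_univ x.1))
      (totalDegree_aeval_X_monomial_le _ _))
  exact card_le_pow_of_linearIndependent hk ((hflag hB.some).length_eq_zero_or_pos (hq _) hL)
    (f := L.get) (fun i => hL _ (List.get_mem L i)) hv hli

/-! ### Primes attached to realizations -/

section

variable {K : Type*} [Field K] {s k : ℕ}

theorem mem_realization_iff {P : Fin s → MvPolynomial (Fin k) K} {ρ : Fin s → Fin 2}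
    {x : Fin k → K} : x ∈ realization P ρ ↔ ∀ i, eval x (P i) = 0 ↔ ρ i = 0 := by
  refine forall_congr' fun i => ?_
  by_cases h : eval x (P i) = 0
  · simp [sz, h, eq_comm]
  · simp only [sz, h, if_false, false_iff]
    exact ⟨fun h => by simp [← h], fun h => (Fin.eq_one_of_ne_zero _ h).symm⟩

/-- The prime of a component of maximal dimension of the closure of a realization. With `D` the
product of the polynomials that do not vanish on the realization, the vanishing ideal of the latter
is `√(P i : ρ i = 0) : D`, by the Nullstellensatz. -/
theorem exists_prime_of_zariskiDim_realization_eq [IsAlgClosed K]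
    {P : Fin s → MvPolynomial (Fin k) K} {ρ : Fin s → Fin 2} {l : ℕ}
    (h : zariskiDim (realization P ρ) = l) :
    ∃ q : Ideal (MvPolynomial (Fin k) K), q.IsPrime ∧ (∀ i, P i ∈ q ↔ ρ i = 0) ∧
      q ∈ (Ideal.span {x | ∃ i, P i = x ∧ x ∈ q}).minimalPrimes ∧
      ringKrullDim (MvPolynomial (Fin k) K ⧸ q) = l := by
  classical
  obtain ⟨q, hq, hdim⟩ := exists_mem_minimalPrimes_ringKrullDim_eq h
  have hqp := hq.isPrime
  set D : MvPolynomial (Fin k) K := ∏ i with ρ i ≠ 0, P i with hD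
  have hDx : ∀ x ∈ realization P ρ, eval x D ≠ 0 := by
    intro x hx
    rw [hD, map_prod, Finset.prod_ne_zero_iff]
    intro i hi
    exact fun h0 => (Finset.mem_filter.mp hi).2 ((mem_realization_iff.mp hx i).mp h0)
  -- otherwise `D` would be a zero divisor modulo the vanishing ideal of the realization
  have hDq : D ∉ q := by
    intro hDq
    obtain ⟨y, hy, hDy⟩ := Ideal.exists_mul_mem_of_mem_minimalPrimes hq hDq
    refine hy fun x hx => ?_
    have h1 := hDy x hx
    rw [map_mul] at h1
    exact (mul_eq_zero.mp h1).resolve_left (hDx x hx)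
  have hiff : ∀ i, P i ∈ q ↔ ρ i = 0 := by
    refine fun i => ⟨fun hi => ?_, fun hi => hq.le fun x hx => (mem_realization_iff.mp hx i).mpr hi⟩
    by_contra hne
    exact hDq (Ideal.mem_of_dvd q
      (Finset.dvd_prod_of_mem P (Finset.mem_filter.mpr ⟨Finset.mem_univ i, hne⟩)) hi)
  refine ⟨q, hqp, hiff, ⟨⟨hqp, Ideal.span_le.mpr fun x hx => hx.choose_spec.2⟩, ?_⟩, hdim⟩
  rintro q' ⟨hq', hle⟩ hq'q
  refine hq.2 ⟨hq', fun f hf => ?_⟩ hq'q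
  have hmem : f * D ∈ q' := by
    have : f * D ∈ vanishingIdeal K (zeroLocus K (Ideal.span {x | ∃ i, P i = x ∧ x ∈ q})) := by
      intro x hx
      by_cases hxr : x ∈ realization P ρ
      · rw [map_mul, hf x hxr, zero_mul]
      · rw [mem_realization_iff, not_forall] at hxr
        obtain ⟨i, hi⟩ := hxr
        have hi0 : ρ i ≠ 0 := fun h0 => hi ⟨fun _ => h0, fun _ =>
          hx _ (Ideal.subset_span ⟨i, rfl, (hiff i).mpr h0⟩)⟩
        have hPi : eval x (P i) = 0 := by tauto
        have hDi : P i ∣ D :=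
          Finset.dvd_prod_of_mem P (Finset.mem_filter.mpr ⟨Finset.mem_univ i, hi0⟩)
        obtain ⟨c, hc⟩ := hDi
        rw [hc, map_mul, map_mul]
        simp [aeval_eq_eval, hPi]
    rw [vanishingIdeal_zeroLocus_eq_radical] at this
    exact hq'.radical_le_iff.mpr hle this
  exact (hq'.mem_or_mem hmem).resolve_right fun h => hDq (hq'q h)

theorem exists_zariskiDim_eq_of_nonempty {S : Set (Fin k → K)} (hS : S.Nonempty) :
    ∃ l ≤ k, zariskiDim S = (l : WithBot ℕ∞) := by
  have hne : vanishingIdeal K S ≠ ⊤ := by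
    obtain ⟨x, hx⟩ := hS
    intro h
    have h1 : (1 : MvPolynomial (Fin k) K) ∈ vanishingIdeal K S := h ▸ trivial
    simpa using h1 x hx
  have := Ideal.Quotient.nontrivial_iff.mpr hne
  have h0 : 0 ≤ zariskiDim S := ringKrullDim_nonneg_of_nontrivial
  have h1 : zariskiDim S ≤ k := by
    refine (ringKrullDim_quotient_le (vanishingIdeal K S)).trans ?_
    simp
  obtain ⟨e, he⟩ := WithBot.ne_bot_iff_exists.mp (ne_bot_of_le_ne_bot (by simp) h0)
  rw [← he] at h1 ⊢
  have h2 : e ≤ k := by exact_mod_cast h1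
  lift e to ℕ using ne_top_of_le_ne_top (ENat.natCast_ne_top k) h2
  exact ⟨e, by exact_mod_cast h2, rfl⟩

theorem ncard_zeroPatterns_zariskiDim_eq_le [IsAlgClosed K] {d : ℕ}
    (P : Fin s → MvPolynomial (Fin k) K) (hP : ∀ i, (P i).totalDegree ≤ d) {l : ℕ} (hl : l ≤ k) :
    {ρ ∈ zeroPatterns P | zariskiDim (realization P ρ) = (l : WithBot ℕ∞)}.ncard
      ≤ s.choose (k - l) * d ^ (k - l) := by
  classical
  set Z := {ρ ∈ zeroPatterns P | zariskiDim (realization P ρ) = (l : WithBot ℕ∞)}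
  choose q hq hiff hmin hdim using fun ρ : Z => exists_prime_of_zariskiDim_realization_eq ρ.2.2
  have hinj : Function.Injective q := by
    intro ρ ρ' h
    refine Subtype.ext (funext fun i => ?_)
    have h1 : ρ.1 i = 0 ↔ ρ'.1 i = 0 := by rw [← hiff ρ i, ← hiff ρ' i, h]
    omega
  have hflag : ∀ ρ : Z, ∃ L : List (Fin s), L.Sublist (List.finRange s) ∧
      IsFlag (q ρ) ⊥ (L.map P) ∧ l + L.length = k := by
    intro ρ
    obtain ⟨L, hL, hf, hd⟩ := exists_isFlag K P (hmin ρ) (List.finRange s)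
      Ideal.isPrime_bot bot_le fun i _ => .inl (List.mem_finRange i)
    refine ⟨L, hL, hf, ?_⟩
    rw [hdim, ringKrullDim_eq_of_ringEquiv (RingEquiv.quotientBot _),
      MvPolynomial.ringKrullDim_of_isNoetherianRing] at hd
    simp only [ringKrullDim_eq_zero_of_field, Nat.card_eq_fintype_card, Fintype.card_fin,
      zero_add] at hd
    exact_mod_cast hd.symm
  choose L hsub hfl hlen using hflag
  have hfin : Finite Z := inferInstance
  have := Fintype.ofFinite Z
  rw [← Nat.card_coe_set_eq, Nat.card_eq_fintype_card, ← Finset.card_univ, mul_comm]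
  set T := (List.sublistsLen (k - l) (List.finRange s)).toFinset
  have hT : T.card ≤ s.choose (k - l) := by
    refine (List.toFinset_card_le _).trans ?_
    rw [List.length_sublistsLen, List.length_finRange]
  refine le_trans (Finset.card_le_mul_card_image_of_maps_to (f := L) (t := T) (fun ρ _ => ?_)
    (d ^ (k - l)) fun M hM => ?_) (Nat.mul_le_mul_left _ hT)
  · rw [List.mem_toFinset, List.mem_sublistsLen]
    exact ⟨hsub ρ, by have := hlen ρ; omega⟩
  · rw [List.mem_toFinset, List.mem_sublistsLen] at hM
    have h := card_le_pow_of_isFlag (B := {ρ : Z // L ρ = M}) (d := d) (L := M.map P)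
      (fun ρ => q ρ.1) (fun ρ => hq ρ.1) (hinj.comp Subtype.val_injective) (fun ρ => hdim ρ.1)
      (by
        intro f hf
        obtain ⟨i, -, rfl⟩ := List.mem_map.mp hf
        exact hP i)
      (by rw [List.length_map, hM.2]; omega) (by rintro ⟨ρ, rfl⟩; exact hfl ρ)
    rw [List.length_map, hM.2, Nat.card_eq_fintype_card, Fintype.card_subtype] at h
    exact h

end

theorem theorem2 {K : Type*} [Field K] [IsAlgClosed K] [CharZero K] (s d k : ℕ)
    (P : Fin s → MvPolynomial (Fin k) K) (hP : ∀ i, (P i).totalDegree ≤ d) :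
    (∀ ℓ : ℕ, ℓ ≤ k →
      {ρ ∈ zeroPatterns P | zariskiDim (realization P ρ) = (ℓ : WithBot ℕ∞)}.ncard
        ≤ s.choose (k - ℓ) * d ^ (k - ℓ)) ∧
    (zeroPatterns P).ncard ≤ ∑ ℓ ∈ Finset.range (k + 1), s.choose (k - ℓ) * d ^ (k - ℓ) := by
  refine ⟨fun l hl => ncard_zeroPatterns_zariskiDim_eq_le P hP hl, ?_⟩
  have hsub : zeroPatterns P ⊆ ⋃ l ∈ Finset.range (k + 1),
      {ρ ∈ zeroPatterns P | zariskiDim (realization P ρ) = (l : WithBot ℕ∞)} := by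
    intro ρ hρ
    obtain ⟨l, hl, h⟩ := exists_zariskiDim_eq_of_nonempty hρ
    exact Set.mem_biUnion (Finset.mem_coe.mpr (Finset.mem_range.mpr (by omega))) ⟨hρ, h⟩
  refine (Set.ncard_le_ncard hsub (Set.toFinite _)).trans
    ((Finset.set_ncard_biUnion_le _ _).trans (Finset.sum_le_sum fun l hl => ?_))
  exact ncard_zeroPatterns_zariskiDim_eq_le P hP (by simpa [Nat.lt_succ_iff] using hl)
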